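/- Conventions. Let $k\ge 1$ and let $U\subseteq\mathbb{R}^n$ be open. A $j$-form on $U$ is any map $U\to\Lambda^j(\mathbb{R}^n)^*$ (no regularity assumed). A $j$-block is a product $B=\prod_{i=1}^j[a_{i0},a_{i1}]$ with $a_{i0}<a_{i1}$ (a single point if $j=0$); a singular $j$-block of class $C^1$ in $U$ is a map $c:B\to U$ on a $j$-block which near each point of $B$ is the restriction of a $C^1$ map defined on an open subset of $\mathbb{R}^j$; a $C^1$ $j$-chain in $U$ is a formal finite $\mathbb{Z}$-linear combination of these. For $j\ge 1$ the boundary is $\partial c=\sum_{i=1}^j\sum_{l=0}^1(-1)^{i+l}c_{il}$, where $c_{il}$ is obtained from $c$ by fixing the $i$-th variable equal to $a_{il}$. For a $j$-form $\omega$, $\int_c\omega$ is the Riemann integral over $B$ of the coefficient $(c^*\omega)(e_1,\dots,e_j)$, extended linearly to chains; $\omega$ is integrable on a chain if the integral over each of its singular blocks exists. A block $B\subseteq\mathbb{R}^j$ is identified with the singular block given by the inclusion. A $(k-1)$-form $\omega$ on $U$ is derivable at $x\in U$ if the following two conditions hold. (a) For every $C^1$ map $\varphi:A\to U$ from an open set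 $A\subseteq\mathbb{R}^k$, every $p\in A$ with $\varphi(p)=x$ and every $k$-block $B\subseteq A$ with $p\in B$, the form $\varphi^*\omega$ is integrable on $\partial B$. (b) There is a $k$-form $\mathrm{D}\omega_x\in\Lambda^k(\mathbb{R}^n)^*$ such that, for all $v_1,\dots,v_k\in\mathbb{R}^n$ and all $\varphi:A\to U$, $p$ as in (a) with $\varphi'(p)e_i=v_i$ for $i=1,\dots,k$, one has: for all $\varepsilon>0$ and $K>1$ there is $\delta>0$ such that every $k$-block $B\subseteq A$ with $p\in B$, longest side $L(B)<\delta$ and $L(B)/l(B)<K$ ($l(B)$ being the shortest side) satisfies $$\Bigl|\mathrm{D}\omega_x(v_1,\dots,v_k)-\frac1{\mathrm{vol}(B)}\int_{\partial B}\varphi^*\omega\Bigr|<\varepsilon .$$ The form $\mathrm{D}\omega_x$ is then unique. If $\omega$ is derivable at every point of $U$, it is called derivable on $U$, and $\mathrm{D}\omega$ denotes the resulting $k$-form on $U$. Theorem ($\mathrm{D}^2=0$). Let $k\ge1$, let $U\subseteq\mathbb{R}^n$ be open, and let $\omega$ be a $(k-1)$-form that is continuous on $U$ and derivable on $U$, and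 such that $\mathrm{D}\omega$ is integrable on every $k$-chain of class $C^1$ in $U$. Then $\mathrm{D}\omega$ is derivable on $U$, and $\mathrm{D}(\mathrm{D}\omega)=0$ on $U$. -/

import Mathlib

noncomputable section

namespace FluxForm

open Set BoxIntegral

variable {E : Type*} [NormedAddCommGroup E] [NormedSpace ℝ E]

/-- Differential `k`-forms, with no regularity. A form on an open set `U` is represented by a total
function; only its values on `U` enter the notions below. -/
abbrev DiffForm (E : Type*) [NormedAddCommGroup E] [NormedSpace ℝ E] (k : ℕ) :=
  E → E [⋀^Fin k]→L[ℝ] ℝ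

/-- A map on an arbitrary subset `X` of `ℝ^k` is of class `C¹` if around every point of `X` it is
the restriction of a `C¹` map defined on an open set. -/
def IsC1On {k : ℕ} (f : (Fin k → ℝ) → E) (X : Set (Fin k → ℝ)) : Prop :=
  ∀ x ∈ X, ∃ V : Set (Fin k → ℝ), IsOpen V ∧ x ∈ V ∧
    ∃ F : (Fin k → ℝ) → E, ContDiffOn ℝ 1 F V ∧ EqOn f F (V ∩ X)

/-- A singular `k`-block of class `C¹` in `U`. The `k`-block is the closed box `Box.Icc block`,
a product of nondegenerate compact intervals; for `k = 0` it is a single point. Only the values of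
`toFun` on that box are relevant. -/
structure SingularBlock (U : Set E) (k : ℕ) where
  block : Box (Fin k)
  toFun : (Fin k → ℝ) → E
  isC1On : IsC1On toFun (Box.Icc block)
  mapsTo : MapsTo toFun (Box.Icc block) U

/-- The endpoint `a_{ij}` of the `i`-th side of a block: the lower one for `j = 0`, the upper one
for `j = 1`. -/
def endpoint {k : ℕ} (B : Box (Fin k)) (i : Fin k) (j : Fin 2) : ℝ :=
  if j = 0 then B.lower i else B.upper i

theorem endpoint_mem {k : ℕ} (B : Box (Fin k)) (i : Fin k) (j : Fin 2) :
    endpoint B i j ∈ Icc (B.lower i) (B.upper i) := by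
  unfold endpoint
  split_ifs
  · exact left_mem_Icc.2 (B.lower_le_upper i)
  · exact right_mem_Icc.2 (B.lower_le_upper i)

theorem contDiff_insertNth {m : ℕ} (i : Fin (m + 1)) (a : ℝ) :
    ContDiff ℝ 1 (fun t : Fin m → ℝ => (i.insertNth a t : Fin (m + 1) → ℝ)) := by
  rw [contDiff_pi]
  intro l
  refine Fin.succAboveCases i ?_ (fun l' => ?_) l
  · simpa using contDiff_const
  · simpa using contDiff_apply ℝ ℝ l'

theorem SingularBlock.isC1On_face {U : Set E} {m : ℕ} (c : SingularBlock U (m + 1))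
    (i : Fin (m + 1)) (j : Fin 2) :
    IsC1On (fun t => c.toFun (i.insertNth (endpoint c.block i j) t))
      (Box.Icc (c.block.face i)) := by
  intro t ht
  have hmaps := Box.mapsTo_insertNth_face_Icc (I := c.block) (endpoint_mem c.block i j)
  obtain ⟨V, hV, hxV, F, hF, hcF⟩ := c.isC1On _ (hmaps ht)
  have hι := contDiff_insertNth i (endpoint c.block i j)
  refine ⟨_, hV.preimage hι.continuous, hxV, fun t => F (i.insertNth (endpoint c.block i j) t),
    hF.comp hι.contDiffOn (fun _ h => h), ?_⟩
  intro s hs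
  exact hcF ⟨hs.1, hmaps hs.2⟩

/-- The face `c_{ij}` of a singular block: the `i`-th variable is frozen at `a_{ij}`. -/
def SingularBlock.face {U : Set E} {m : ℕ} (c : SingularBlock U (m + 1)) (i : Fin (m + 1))
    (j : Fin 2) : SingularBlock U m where
  block := c.block.face i
  toFun t := c.toFun (i.insertNth (endpoint c.block i j) t)
  isC1On := c.isC1On_face i j
  mapsTo := fun _ ht =>
    c.mapsTo (Box.mapsTo_insertNth_face_Icc (I := c.block) (endpoint_mem c.block i j) ht)

/-- `C¹` `k`-chains in `U`: formal finite sums of singular `k`-blocks with integer coefficients. -/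
abbrev Chain (U : Set E) (k : ℕ) := SingularBlock U k →₀ ℤ

/-- The boundary `∑ᵢ ∑ⱼ (-1)^(i+j) c_{ij}` of a singular block, where `i` runs over `1, …, k`
(here `i` is counted from `0`, hence the shift by one in the sign). -/
def SingularBlock.boundary {U : Set E} {m : ℕ} (c : SingularBlock U (m + 1)) : Chain U m :=
  ∑ i : Fin (m + 1), ∑ j : Fin 2,
    Finsupp.single (c.face i j) ((-1 : ℤ) ^ ((i : ℕ) + 1 + (j : ℕ)))

/-- The coefficient function of `c^* ω` with respect to `dx¹ ∧ ⋯ ∧ dx^k` on the block of `c`. -/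
def SingularBlock.pullbackCoeff {U : Set E} {k : ℕ} (c : SingularBlock U k) (ω : DiffForm E k) :
    (Fin k → ℝ) → ℝ := fun t =>
  (ω (c.toFun t)).compContinuousLinearMap (fderivWithin ℝ c.toFun (Box.Icc c.block) t)
    (fun i => Pi.single i 1)

/-- The Riemann integral of `c^* ω` over the block of `c` exists. -/
def SingularBlock.IsIntegrable {U : Set E} {k : ℕ} (c : SingularBlock U k) (ω : DiffForm E k) :
    Prop :=
  BoxIntegral.Integrable c.block IntegrationParams.Riemann (c.pullbackCoeff ω)
    BoxAdditiveMap.volume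

/-- The Riemann integral `∫_c ω` over a singular block. -/
def SingularBlock.integral {U : Set E} {k : ℕ} (c : SingularBlock U k) (ω : DiffForm E k) : ℝ :=
  BoxIntegral.integral c.block IntegrationParams.Riemann (c.pullbackCoeff ω) BoxAdditiveMap.volume

/-- A form is integrable on a chain if it is integrable on each of its singular blocks. -/
def Chain.IsIntegrable {U : Set E} {k : ℕ} (c : Chain U k) (ω : DiffForm E k) : Prop :=
  ∀ s ∈ c.support, s.IsIntegrable ω

/-- The integral of a form over a chain. -/
def Chain.integral {U : Set E} {k : ℕ} (c : Chain U k) (ω : DiffForm E k) : ℝ :=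
  c.sum fun s a => (a : ℝ) * s.integral ω

theorem isC1On_id {k : ℕ} (X : Set (Fin k → ℝ)) : IsC1On (id : (Fin k → ℝ) → Fin k → ℝ) X :=
  fun _ _ => ⟨univ, isOpen_univ, mem_univ _, id, contDiff_id.contDiffOn, fun _ _ => rfl⟩

/-- A `k`-block contained in `A ⊆ ℝ^k`, as a singular block in `A` (the inclusion map). -/
def inclusionBlock {k : ℕ} {A : Set (Fin k → ℝ)} (B : Box (Fin k)) (hB : Box.Icc B ⊆ A) :
    SingularBlock A k where
  block := B
  toFun := id
  isC1On := isC1On_id _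
  mapsTo := fun _ h => hB h

/-- The pullback `φ^* ω` of a form under a map from an open subset of `ℝ^k`. -/
def pullback {k l : ℕ} (φ : (Fin k → ℝ) → E) (ω : DiffForm E l) : DiffForm (Fin k → ℝ) l :=
  fun t => (ω (φ t)).compContinuousLinearMap (fderiv ℝ φ t)

/-- The length of the longest side of a block. -/
def longSide {k : ℕ} (B : Box (Fin k)) : ℝ := ⨆ i, (B.upper i - B.lower i)

/-- The length of the shortest side of a block. -/
def shortSide {k : ℕ} (B : Box (Fin k)) : ℝ := ⨅ i, (B.upper i - B.lower i)

/-- The volume of a block. -/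
def vol {k : ℕ} (B : Box (Fin k)) : ℝ := ∏ i, (B.upper i - B.lower i)

/-- `φ : A → U` is a `C¹` map from an open subset `A` of `ℝ^k`, and `p ∈ A` is sent to `x`. -/
structure IsC1Through {k : ℕ} (U : Set E) (x : E) (A : Set (Fin k → ℝ)) (φ : (Fin k → ℝ) → E)
    (p : Fin k → ℝ) : Prop where
  isOpen : IsOpen A
  contDiffOn : ContDiffOn ℝ 1 φ A
  mapsTo : MapsTo φ A U
  mem : p ∈ A
  map_eq : φ p = x

/-- Flux-integrability around `x` of an `m`-form on `U`. -/
def FluxIntegrableAround {m : ℕ} (U : Set E) (ω : DiffForm E m) (x : E) : Prop :=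
  ∀ (A : Set (Fin (m + 1) → ℝ)) (φ : (Fin (m + 1) → ℝ) → E) (p : Fin (m + 1) → ℝ),
    IsC1Through U x A φ p → ∀ (B : Box (Fin (m + 1))) (hB : Box.Icc B ⊆ A), p ∈ Box.Icc B →
      Chain.IsIntegrable (inclusionBlock B hB).boundary (pullback φ ω)

/-- The `m`-form `ω` on `U` is derivable at `x`, with exterior derivative `η`: `η` is the
infinitesimal flux of `ω`, the limit being taken along blocks containing `p` that shrink to `p`
with bounded ratio of longest to shortest side. -/
def HasExtDerivAt {m : ℕ} (U : Set E) (ω : DiffForm E m) (η : E [⋀^Fin (m + 1)]→L[ℝ] ℝ)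
    (x : E) : Prop :=
  FluxIntegrableAround U ω x ∧
  ∀ (v : Fin (m + 1) → E) (A : Set (Fin (m + 1) → ℝ)) (φ : (Fin (m + 1) → ℝ) → E)
    (p : Fin (m + 1) → ℝ), IsC1Through U x A φ p → (∀ i, fderiv ℝ φ p (Pi.single i 1) = v i) →
    ∀ ε > (0 : ℝ), ∀ K > (1 : ℝ), ∃ δ > (0 : ℝ), ∀ (B : Box (Fin (m + 1))) (hB : Box.Icc B ⊆ A),
      p ∈ Box.Icc B → longSide B < δ → longSide B / shortSide B < K →
        |η v - 1 / vol B * Chain.integral (inclusionBlock B hB).boundary (pullback φ ω)| < ε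

/-- Derivability at a point. -/
def DerivableAt {m : ℕ} (U : Set E) (ω : DiffForm E m) (x : E) : Prop :=
  ∃ η, HasExtDerivAt U ω η x

open Classical in
/-- The exterior derivative `D ω` of a form on `U` (with value `0` where `ω` is not derivable). -/
def D {m : ℕ} (U : Set E) (ω : DiffForm E m) : DiffForm E (m + 1) := fun x =>
  if h : DerivableAt U ω x then h.choose else 0

/-- The exterior derivative at a point is unique, so that `D` is well defined. -/
theorem HasExtDerivAt.unique {m : ℕ} {U : Set E} (hU : IsOpen U) {ω : DiffForm E m}
    {η η' : E [⋀^Fin (m + 1)]→L[ℝ] ℝ} {x : E} (hx : x ∈ U) (h : HasExtDerivAt U ω η x)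
    (h' : HasExtDerivAt U ω η' x) : η = η' := by
  ext v
  by_contra hne
  let L : (Fin (m + 1) → ℝ) →L[ℝ] E :=
    ∑ i, (ContinuousLinearMap.proj (R := ℝ) (φ := fun _ : Fin (m + 1) => ℝ) i).smulRight (v i)
  let φ : (Fin (m + 1) → ℝ) → E := fun t => x + L t
  have hφ : ContDiff ℝ 1 φ := contDiff_const.add L.contDiff
  have hd : ∀ i, fderiv ℝ φ 0 (Pi.single i 1) = v i := by
    intro i
    have : HasFDerivAt φ L 0 := L.hasFDerivAt.const_add x
    rw [this.fderiv]
    simp [L, Pi.single_apply]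
  have hA : IsC1Through U x (φ ⁻¹' U) φ 0 :=
    ⟨hU.preimage hφ.continuous, hφ.contDiffOn, fun _ h => h, by simpa [φ] using hx, by simp [φ]⟩
  have hε : 0 < |η v - η' v| / 2 := half_pos (abs_pos.2 (sub_ne_zero.2 hne))
  obtain ⟨δ, hδ, H⟩ := h.2 v _ φ 0 hA hd _ hε 2 one_lt_two
  obtain ⟨δ', hδ', H'⟩ := h'.2 v _ φ 0 hA hd _ hε 2 one_lt_two
  obtain ⟨r, hr, hball⟩ := Metric.isOpen_iff.1 hA.isOpen 0 hA.mem
  set s : ℝ := min (min δ δ') r / 2 with hs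
  have hmin : 0 < min (min δ δ') r := lt_min (lt_min hδ hδ') hr
  have hs0 : 0 < s := half_pos hmin
  have hsm : s < min (min δ δ') r := half_lt_self hmin
  let B : Box (Fin (m + 1)) := ⟨fun _ => 0, fun _ => s, fun _ => hs0⟩
  have hB : Box.Icc B ⊆ φ ⁻¹' U := by
    intro t ht
    apply hball
    rw [mem_ball_zero_iff, pi_norm_lt_iff hr]
    intro i
    have h0 : 0 ≤ t i := ht.1 i
    have h1 : t i ≤ s := ht.2 i
    rw [Real.norm_eq_abs, abs_of_nonneg h0]
    exact lt_of_le_of_lt h1 (hsm.trans_le (min_le_right _ _))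
  have hp : (0 : Fin (m + 1) → ℝ) ∈ Box.Icc B := ⟨fun _ => le_rfl, fun _ => hs0.le⟩
  have hL : longSide B = s := by simp [longSide, B]
  have hl : shortSide B = s := by simp [shortSide, B]
  have hr1 : longSide B / shortSide B < 2 := by
    rw [hL, hl, div_self hs0.ne']; exact one_lt_two
  have e1 := H B hB hp (by rw [hL]; exact hsm.trans_le ((min_le_left _ _).trans (min_le_left _ _)))
    hr1
  have e2 := H' B hB hp
    (by rw [hL]; exact hsm.trans_le ((min_le_left _ _).trans (min_le_right _ _))) hr1
  rw [abs_sub_comm] at e2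
  have := abs_sub_le (η v) (1 / vol B * Chain.integral (inclusionBlock B hB).boundary (pullback φ ω))
    (η' v)
  linarith

end FluxForm

end

/-! Let `φ` be a C¹ test map and `B` a block in its domain. On a face of `B`, `φ` restricts to a C¹
map on an open set one dimension lower, hence to a test map for `ω` itself. Stokes on the face
(`integral_pullback_D`) turns the integral of the pullback of `D ω` into the flux of the pullback of
`ω` through the boundary of the face, and these fluxes cancel in pairs (`sum_flux_faces_eq_zero`).
So `D ω` has flux exactly 0 through every block boundary, and its derivative is 0.

Stokes holds without continuity of `D ω`: the flux of `ω` is an additive function of blocks whose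
derivative along blocks of bounded distortion exists at every point. The generalized Perron integral
`GP` recovers an additive function from such a derivative (`hasIntegral_flux`), and it agrees with
the Riemann integral whenever the latter exists. -/

noncomputable section

namespace FluxForm

open Set BoxIntegral

variable {E : Type*} [NormedAddCommGroup E] [NormedSpace ℝ E]

/-! ### Face inclusions and integrals on closed blocks -/

/-- The linear part of the affine map `Fin.insertNth i a`. -/
def insertZero {m : ℕ} (i : Fin (m + 1)) : (Fin m → ℝ) →L[ℝ] (Fin (m + 1) → ℝ) :=
  ContinuousLinearMap.pi (i.insertNth (α := fun _ => (Fin m → ℝ) →L[ℝ] ℝ) 0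
    (fun l => ContinuousLinearMap.proj l))

theorem insertZero_single {m : ℕ} (i : Fin (m + 1)) (l : Fin m) :
    insertZero i (Pi.single l 1) = Pi.single (i.succAbove l) 1 := by
  ext k
  refine Fin.succAboveCases i ?_ (fun k' => ?_) k
  · simp [insertZero]
  · simp [insertZero, Pi.single_apply]

theorem hasFDerivAt_insertNth {m : ℕ} (i : Fin (m + 1)) (a : ℝ) (t : Fin m → ℝ) :
    HasFDerivAt (fun t : Fin m → ℝ => (i.insertNth a t : Fin (m + 1) → ℝ)) (insertZero i) t := by
  rw [hasFDerivAt_pi']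
  intro k
  refine Fin.succAboveCases i ?_ (fun k' => ?_) k
  · have : (ContinuousLinearMap.proj (R := ℝ) (φ := fun _ : Fin (m + 1) => ℝ) i).comp
        (insertZero i) = 0 := by ext; simp [insertZero]
    rw [this]
    simpa using hasFDerivAt_const a t
  · have : (ContinuousLinearMap.proj (R := ℝ) (φ := fun _ : Fin (m + 1) => ℝ)
        (i.succAbove k')).comp (insertZero i) = ContinuousLinearMap.proj k' := by
      ext; simp [insertZero]
    rw [this]
    simpa using hasFDerivAt_apply k' t

/-- Makes `fderivWithin` on a block equal to the derivative of any differentiable extension, even at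
boundary points. -/
theorem uniqueDiffOn_boxIcc {k : ℕ} (B : Box (Fin k)) : UniqueDiffOn ℝ (Box.Icc B) := by
  rw [Box.Icc_eq_pi]
  exact UniqueDiffOn.univ_pi fun i => uniqueDiffOn_Icc (B.lower_lt_upper i)

theorem integrable_congr {k : ℕ} {B : Box (Fin k)} {l : IntegrationParams}
    {f g : (Fin k → ℝ) → ℝ} (h : EqOn f g (Box.Icc B)) :
    Integrable B l f BoxAdditiveMap.volume ↔ Integrable B l g BoxAdditiveMap.volume :=
  exists_congr fun y => hasIntegral_congr B l h (fun _ _ => rfl) y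

theorem integral_congr {k : ℕ} {B : Box (Fin k)} {l : IntegrationParams}
    {f g : (Fin k → ℝ) → ℝ} (h : EqOn f g (Box.Icc B)) :
    integral B l f BoxAdditiveMap.volume = integral B l g BoxAdditiveMap.volume := by
  by_cases hg : Integrable B l g BoxAdditiveMap.volume
  · exact ((hasIntegral_congr B l h (fun _ _ => rfl) _).2 hg.hasIntegral).integral_eq
  · have hf := mt (integrable_congr h).1 hg
    rw [integral, integral, dif_neg hf, dif_neg hg]

/-! ### Flux through the boundary of a block -/

/-- The coefficient of a form `θ` on `ℝ^(m+1)` seen by the faces orthogonal to the `i`-th axis. -/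
def faceCoeff {m : ℕ} (θ : DiffForm (Fin (m + 1) → ℝ) m) (i : Fin (m + 1))
    (x : Fin (m + 1) → ℝ) : ℝ :=
  θ x fun l => Pi.single (i.succAbove l) 1

/-- The integral of `θ` over the block `J` placed in the hyperplane where the `i`-th variable
equals `a`. -/
def faceIntegral {m : ℕ} (θ : DiffForm (Fin (m + 1) → ℝ) m) (i : Fin (m + 1)) (a : ℝ)
    (J : Box (Fin m)) : ℝ :=
  integral J IntegrationParams.Riemann (fun t => faceCoeff θ i (i.insertNth a t))
    BoxAdditiveMap.volume

/-- The flux of `θ` through the boundary of a block. -/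
def flux {m : ℕ} (θ : DiffForm (Fin (m + 1) → ℝ) m) (B : Box (Fin (m + 1))) : ℝ :=
  ∑ i : Fin (m + 1), (-1) ^ (i : ℕ) *
    (faceIntegral θ i (B.upper i) (B.face i) - faceIntegral θ i (B.lower i) (B.face i))

theorem pullbackCoeff_inclusionBlock_face {m : ℕ} {A : Set (Fin (m + 1) → ℝ)}
    (B : Box (Fin (m + 1))) (hB : Box.Icc B ⊆ A) (θ : DiffForm (Fin (m + 1) → ℝ) m)
    (i : Fin (m + 1)) (j : Fin 2) :
    EqOn (((inclusionBlock B hB).face i j).pullbackCoeff θ)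
      (fun t => faceCoeff θ i (i.insertNth (endpoint B i j) t)) (Box.Icc (B.face i)) := by
  intro t ht
  have h : fderivWithin ℝ ((inclusionBlock B hB).face i j).toFun (Box.Icc (B.face i)) t =
      insertZero i :=
    (hasFDerivAt_insertNth i (endpoint B i j) t).hasFDerivWithinAt.fderivWithin
      (uniqueDiffOn_boxIcc _ t ht)
  change θ (i.insertNth (endpoint B i j) t) (fun l => fderivWithin ℝ
    ((inclusionBlock B hB).face i j).toFun (Box.Icc (B.face i)) t (Pi.single l 1)) = _
  rw [h]
  simp only [insertZero_single, faceCoeff]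

theorem SingularBlock.integral_boundary {U : Set E} {m : ℕ} (c : SingularBlock U (m + 1))
    (ω : DiffForm E m) :
    Chain.integral c.boundary ω =
      ∑ i : Fin (m + 1), ∑ j : Fin 2,
        (-1) ^ ((i : ℕ) + 1 + (j : ℕ)) * (c.face i j).integral ω := by
  have h0 : ∀ s : SingularBlock U m, ((0 : ℤ) : ℝ) * s.integral ω = 0 := by simp
  have hadd : ∀ (s : SingularBlock U m) (a b : ℤ),
      ((a + b : ℤ) : ℝ) * s.integral ω = (a : ℝ) * s.integral ω + (b : ℝ) * s.integral ω := by
    intros; push_cast; ring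
  rw [Chain.integral, SingularBlock.boundary, ← Finsupp.sum_finsetSum_index h0 hadd]
  refine Finset.sum_congr rfl fun i _ => ?_
  rw [← Finsupp.sum_finsetSum_index h0 hadd]
  refine Finset.sum_congr rfl fun j _ => ?_
  rw [Finsupp.sum_single_index (h0 _)]
  push_cast
  rfl

theorem integral_boundary_inclusionBlock {m : ℕ} {A : Set (Fin (m + 1) → ℝ)}
    (B : Box (Fin (m + 1))) (hB : Box.Icc B ⊆ A) (θ : DiffForm (Fin (m + 1) → ℝ) m) :
    Chain.integral (inclusionBlock B hB).boundary θ = flux θ B := by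
  have h : ∀ i j, ((inclusionBlock B hB).face i j).integral θ =
      faceIntegral θ i (endpoint B i j) (B.face i) := fun i j =>
    integral_congr (pullbackCoeff_inclusionBlock_face B hB θ i j)
  rw [SingularBlock.integral_boundary, flux]
  refine Finset.sum_congr rfl fun i _ => ?_
  simp only [h, Fin.sum_univ_two, endpoint]
  simp [pow_add]
  ring

/-- Coinciding faces may cancel in the chain, so the support is only contained in the set of faces;
that inclusion suffices. -/
theorem isIntegrable_boundary {U : Set E} {m : ℕ} {c : SingularBlock U (m + 1)}
    {ω : DiffForm E m} (h : ∀ i j, (c.face i j).IsIntegrable ω) :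
    Chain.IsIntegrable c.boundary ω := by
  classical
  intro s hs
  obtain ⟨i, -, hi⟩ := Finset.mem_biUnion.1 (Finsupp.support_finsetSum hs)
  obtain ⟨j, -, hj⟩ := Finset.mem_biUnion.1 (Finsupp.support_finsetSum hi)
  rw [Finset.mem_singleton.1 (Finsupp.support_single_subset hj)]
  exact h i j

/-! ### Stokes' theorem via the generalized Perron integral -/

/-- The flux is an additive function of the block. -/
theorem exists_boxAdditiveMap_eq_flux {m : ℕ} {θ : DiffForm (Fin (m + 1) → ℝ) m}
    {I : Box (Fin (m + 1))} (hθ : ∀ i, ContinuousOn (faceCoeff θ i) (Box.Icc I)) :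
    ∃ g : BoxAdditiveMap (Fin (m + 1)) ℝ I, ∀ J, g J = flux θ J := by
  have hi : ∀ i, ∀ x ∈ Icc (I.lower i) (I.upper i),
      Integrable (I.face i) IntegrationParams.Riemann
        (fun t => faceCoeff θ i (i.insertNth x t)) BoxAdditiveMap.volume := fun i x hx =>
    integrable_of_continuousOn _ (Box.continuousOn_face_Icc (hθ i) hx) MeasureTheory.volume
  -- For each axis, cuts across it telescope and cuts along it split the face integrals additively.
  let F : Fin (m + 1) → BoxAdditiveMap (Fin (m + 1)) ℝ I := fun i =>
    BoxAdditiveMap.upperSubLower I i (faceIntegral θ i)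
      (fun x => (hi i x x.2).toBoxAdditive) fun _ _ _ => rfl
  refine ⟨⟨flux θ, fun J hJ π hπ => ?_⟩, fun J => rfl⟩
  simp only [flux]
  rw [Finset.sum_comm]
  refine Finset.sum_congr rfl fun i _ => ?_
  rw [← Finset.mul_sum]
  congr 1
  exact (F i).sum_partition_boxes hJ hπ

theorem longSide_le_dist {k : ℕ} (B : Box (Fin (k + 1))) : longSide B ≤ dist B.lower B.upper :=
  ciSup_le fun i => by
    have := dist_le_pi_dist B.lower B.upper i
    rw [Real.dist_eq, abs_sub_comm] at this
    exact (le_abs_self _).trans this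

/-- Links the shape condition of `HasExtDerivAt` to the distortion bound built into `GP`. -/
theorem longSide_div_shortSide_le {k : ℕ} (B : Box (Fin (k + 1))) :
    longSide B / shortSide B ≤ B.distortion := by
  obtain ⟨i, hi⟩ := exists_eq_ciInf_of_finite (f := fun i => B.upper i - B.lower i)
  have hs : shortSide B = B.upper i - B.lower i := hi.symm
  rw [hs, div_le_iff₀ (sub_pos.2 (B.lower_lt_upper i))]
  exact (longSide_le_dist B).trans (B.dist_le_distortion_mul i)

theorem vol_pos {k : ℕ} (B : Box (Fin k)) : 0 < vol B :=
  Finset.prod_pos fun i _ => sub_pos.2 (B.lower_lt_upper i)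

/-- A function that is the infinitesimal flux of `θ` at each point of a block, along blocks of
bounded distortion, integrates in the generalized Perron sense to the flux of `θ`. -/
theorem hasIntegral_flux {m : ℕ} {θ : DiffForm (Fin (m + 1) → ℝ) m} {I : Box (Fin (m + 1))}
    (hθ : ∀ i, ContinuousOn (faceCoeff θ i) (Box.Icc I)) {f : (Fin (m + 1) → ℝ) → ℝ}
    (hf : ∀ p ∈ Box.Icc I, ∀ ε > (0 : ℝ), ∀ K > (1 : ℝ), ∃ δ > (0 : ℝ), ∀ J ≤ I, p ∈ Box.Icc J →
      longSide J < δ → longSide J / shortSide J < K → |f p - 1 / vol J * flux θ J| < ε) :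
    HasIntegral I IntegrationParams.GP f BoxAdditiveMap.volume (flux θ I) := by
  obtain ⟨g, hg⟩ := exists_boxAdditiveMap_eq_flux hθ
  rw [← hg]
  refine HasIntegral.of_bRiemann_eq_false_of_forall_isLittleO rfl
    ((MeasureTheory.volume : MeasureTheory.Measure (Fin (m + 1) → ℝ)).toBoxAdditive.restrict _
      le_top) (fun J => ?_) g ∅ countable_empty (fun h => absurd rfl h.ne_empty) (by simp) ?_
  · exact ENNReal.toReal_nonneg
  intro c p hp ε hε
  -- The bound `K` must exceed 1 and strictly exceed `c`, which is only known to be nonnegative.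
  obtain ⟨δ, hδ, H⟩ := hf p hp.1 ε hε (c + 2) (by have := c.coe_nonneg; linarith)
  -- A block in a closed ball of radius `δ / 3` has sides at most `2δ / 3 < δ`.
  refine ⟨δ / 3, by positivity, fun J hJ hJδ hpJ hc => ?_⟩
  have hlong : longSide J < δ := by
    have h1 := hJδ J.lower_mem_Icc
    have h2 := hJδ J.upper_mem_Icc
    rw [Metric.mem_closedBall] at h1 h2
    have := dist_triangle_right J.lower J.upper p
    have := longSide_le_dist J
    linarith
  have hratio : longSide J / shortSide J < c + 2 := by
    have h1 := longSide_div_shortSide_le J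
    have h2 : (J.distortion : ℝ) ≤ c := hc rfl
    linarith
  have h := H J hJ (hpJ rfl) hlong hratio
  have hv := vol_pos J
  have hB : (MeasureTheory.volume : MeasureTheory.Measure (Fin (m + 1) → ℝ)).toBoxAdditive.restrict
      (I : WithTop (Box (Fin (m + 1)))) le_top J = vol J := Box.volume_apply J
  rw [hB, BoxAdditiveMap.volume_apply, hg, Real.dist_eq, smul_eq_mul]
  change |vol J * f p - flux θ J| ≤ ε * vol J
  have e : vol J * f p - flux θ J = (f p - 1 / vol J * flux θ J) * vol J := by
    field_simp
  rw [e, abs_mul, abs_of_pos hv]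
  gcongr

theorem D_spec {m : ℕ} {U : Set E} {ω : DiffForm E m} {x : E} (h : DerivableAt U ω x) :
    HasExtDerivAt U ω (D U ω x) x := by
  rw [D, dif_pos h]
  exact h.choose_spec

/-- The one place where continuity of `ω` enters: it makes every face integral of every subblock
exist, as additivity of the flux requires. -/
theorem continuousOn_faceCoeff_pullback {m : ℕ} {U : Set E} {ω : DiffForm E m}
    (hω : ContinuousOn ω U) {A : Set (Fin (m + 1) → ℝ)} (hA : IsOpen A)
    {φ : (Fin (m + 1) → ℝ) → E} (hφ : ContDiffOn ℝ 1 φ A) (hm : MapsTo φ A U)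
    (i : Fin (m + 1)) : ContinuousOn (faceCoeff (pullback φ ω) i) A := by
  have h1 : ContinuousOn (fun x => ω (φ x)) A := hω.comp hφ.continuousOn hm
  have h2 : ContinuousOn (fderiv ℝ φ) A := hφ.continuousOn_fderiv_of_isOpen hA le_rfl
  have h3 : ContinuousOn
      (fun x => fun l : Fin m => fderiv ℝ φ x (Pi.single (i.succAbove l) 1)) A :=
    continuousOn_pi.2 fun l => h2.clm_apply continuousOn_const
  exact h1.eval h3

/-- Stokes' theorem for a block on which the map is defined and `C¹` in a neighbourhood. -/
theorem integral_pullback_D {m : ℕ} {U : Set E} {ω : DiffForm E m}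
    (hω : ContinuousOn ω U) (hder : ∀ x ∈ U, DerivableAt U ω x)
    {A : Set (Fin (m + 1) → ℝ)} (hA : IsOpen A) {φ : (Fin (m + 1) → ℝ) → E}
    (hφ : ContDiffOn ℝ 1 φ A) (hm : MapsTo φ A U) {B : Box (Fin (m + 1))} (hB : Box.Icc B ⊆ A)
    (hint : Integrable B IntegrationParams.Riemann
      (fun t => pullback φ (D U ω) t fun l => Pi.single l 1) BoxAdditiveMap.volume) :
    integral B IntegrationParams.Riemann
      (fun t => pullback φ (D U ω) t fun l => Pi.single l 1) BoxAdditiveMap.volume =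
        flux (pullback φ ω) B := by
  -- A Riemann integral is also a `GP` integral with the same value, and `GP` integrals are unique.
  refine (hint.hasIntegral.mono IntegrationParams.gp_le).unique (hasIntegral_flux
    (fun i => (continuousOn_faceCoeff_pullback hω hA hφ hm i).mono hB) ?_)
  intro p hp ε hε K hK
  have hpA := hB hp
  obtain ⟨δ, hδ, H⟩ := (D_spec (hder _ (hm hpA))).2 _ A φ p ⟨hA, hφ, hm, hpA, rfl⟩
    (fun _ => rfl) ε hε K hK
  refine ⟨δ, hδ, fun J hJ hpJ h1 h2 => ?_⟩
  have h := H J ((Box.le_iff_Icc.1 hJ).trans hB) hpJ h1 h2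
  rw [integral_boundary_inclusionBlock] at h
  exact h

/-! ### Pullbacks restricted to faces -/

/-- The restriction of a `C¹` map to a face of a block, as a singular block. -/
def faceBlock {m : ℕ} {U : Set E} {A : Set (Fin (m + 1) → ℝ)} {φ : (Fin (m + 1) → ℝ) → E}
    (hA : IsOpen A) (hφ : ContDiffOn ℝ 1 φ A) (hm : MapsTo φ A U) {B : Box (Fin (m + 1))}
    (hB : Box.Icc B ⊆ A) (i : Fin (m + 1)) (j : Fin 2) : SingularBlock U m :=
  SingularBlock.face ⟨B, φ, fun _ hx => ⟨A, hA, hB hx, φ, hφ, fun _ _ => rfl⟩,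
    fun _ hx => hm (hB hx)⟩ i j

/-- The chain rule. The index map `σ` is `id` for the top coefficient on a face, and `j.succAbove`
for the coefficients on the faces of that face. -/
theorem pullback_comp_insertNth {m k : ℕ} {A : Set (Fin (m + 1) → ℝ)}
    {φ : (Fin (m + 1) → ℝ) → E} (hA : IsOpen A) (hφ : ContDiffOn ℝ 1 φ A) (ω : DiffForm E k)
    (i : Fin (m + 1)) (a : ℝ) {t : Fin m → ℝ} (ht : (i.insertNth a t : Fin (m + 1) → ℝ) ∈ A)
    (σ : Fin k → Fin m) :
    pullback (fun s => φ (i.insertNth a s)) ω t (fun l => Pi.single (σ l) 1) =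
      pullback φ ω (i.insertNth a t) (fun l => Pi.single (i.succAbove (σ l)) 1) := by
  have hd : HasFDerivAt (fun s => φ (i.insertNth a s))
      ((fderiv ℝ φ (i.insertNth a t)).comp (insertZero i)) t :=
    (((hφ.contDiffAt (hA.mem_nhds ht)).differentiableAt one_ne_zero).hasFDerivAt).comp t
      (hasFDerivAt_insertNth i a t)
  change ω (φ (i.insertNth a t)) (fun l => fderiv ℝ (fun s => φ (i.insertNth a s)) t
    (Pi.single (σ l) 1)) = ω (φ (i.insertNth a t)) (fun l => fderiv ℝ φ (i.insertNth a t)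
      (Pi.single (i.succAbove (σ l)) 1))
  rw [hd.fderiv]
  simp only [ContinuousLinearMap.comp_apply, insertZero_single]

theorem pullbackCoeff_faceBlock {m : ℕ} {U : Set E} {A : Set (Fin (m + 1) → ℝ)}
    {φ : (Fin (m + 1) → ℝ) → E} (hA : IsOpen A) (hφ : ContDiffOn ℝ 1 φ A) (hm : MapsTo φ A U)
    {B : Box (Fin (m + 1))} (hB : Box.Icc B ⊆ A) (i : Fin (m + 1)) (j : Fin 2)
    (η : DiffForm E m) :
    EqOn ((faceBlock hA hφ hm hB i j).pullbackCoeff η)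
      (fun t => faceCoeff (pullback φ η) i (i.insertNth (endpoint B i j) t))
      (Box.Icc (B.face i)) := by
  intro t ht
  have htA : (i.insertNth (endpoint B i j) t : Fin (m + 1) → ℝ) ∈ A :=
    hB (Box.mapsTo_insertNth_face_Icc (I := B) (endpoint_mem B i j) ht)
  have hd : HasFDerivAt (fun s => φ (i.insertNth (endpoint B i j) s))
      ((fderiv ℝ φ (i.insertNth (endpoint B i j) t)).comp (insertZero i)) t :=
    (((hφ.contDiffAt (hA.mem_nhds htA)).differentiableAt one_ne_zero).hasFDerivAt).comp t
      (hasFDerivAt_insertNth i _ t)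
  have h : fderivWithin ℝ (faceBlock hA hφ hm hB i j).toFun (Box.Icc (B.face i)) t =
      (fderiv ℝ φ (i.insertNth (endpoint B i j) t)).comp (insertZero i) :=
    hd.hasFDerivWithinAt.fderivWithin (uniqueDiffOn_boxIcc _ t ht)
  change η (φ (i.insertNth (endpoint B i j) t)) (fun l => fderivWithin ℝ
    (faceBlock hA hφ hm hB i j).toFun (Box.Icc (B.face i)) t (Pi.single l 1)) =
    η (φ (i.insertNth (endpoint B i j) t)) (fun l => fderiv ℝ φ (i.insertNth (endpoint B i j) t)
      (Pi.single (i.succAbove l) 1))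
  rw [h]
  simp only [ContinuousLinearMap.comp_apply, insertZero_single]

/-! ### Cancellation on the boundary of the boundary -/

/-- The pairs `(i, j)` and `(i.succAbove j, j.predAbove i)` remove the same two coordinates in
opposite orders. -/
theorem insertNth_insertNth_eq_swap {m : ℕ} (i : Fin (m + 2)) (j : Fin (m + 1)) (a b : ℝ)
    (s : Fin m → ℝ) :
    (i.insertNth a (j.insertNth b s : Fin (m + 1) → ℝ) : Fin (m + 2) → ℝ) =
      (i.succAbove j).insertNth b ((j.predAbove i).insertNth a s : Fin (m + 1) → ℝ) := by
  ext k
  refine Fin.succAboveCases i ?_ (fun k' => ?_) k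
  · have h := Fin.insertNth_apply_succAbove (α := fun _ => ℝ) (i.succAbove j) b
      ((j.predAbove i).insertNth a s) (j.predAbove i)
    rw [Fin.succAbove_succAbove_predAbove, Fin.insertNth_apply_same] at h
    rw [h, Fin.insertNth_apply_same]
  · refine Fin.succAboveCases j ?_ (fun l => ?_) k'
    · simp
    · conv_rhs => rw [← Fin.succAbove_succAbove_succAbove_predAbove i j l]
      simp

theorem face_face_eq_swap {m : ℕ} (B : Box (Fin (m + 2))) (i : Fin (m + 2)) (j : Fin (m + 1)) :
    (B.face i).face j = (B.face (i.succAbove j)).face (j.predAbove i) := by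
  rcases B with ⟨l, u, h⟩
  simp only [Box.face_mk, Box.mk.injEq]
  constructor <;> ext k <;> simp [Fin.succAbove_succAbove_succAbove_predAbove]

/-- The swap of removal orders is an involution without fixed points that reverses the sign. -/
theorem sum_neg_one_pow_mul_eq_zero {m : ℕ} (T : Fin (m + 2) → Fin (m + 1) → ℝ)
    (hT : ∀ i j, T i j = T (i.succAbove j) (j.predAbove i)) :
    ∑ i : Fin (m + 2), ∑ j : Fin (m + 1), (-1) ^ ((i : ℕ) + (j : ℕ)) * T i j = 0 := by
  rw [← Finset.sum_product']
  refine Finset.sum_involution (fun q _ => (q.1.succAbove q.2, q.2.predAbove q.1)) ?_ ?_ ?_ ?_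
  · rintro ⟨i, j⟩ -
    simp only [← hT, Fin.neg_one_pow_succAbove_add_predAbove]
    ring
  · rintro ⟨i, j⟩ - - h
    exact Fin.succAbove_ne i j (Prod.ext_iff.1 h).1
  · simp
  · rintro ⟨i, j⟩ -
    have h := Fin.succAbove_succAbove_predAbove i j
    refine Prod.ext h (Fin.succAbove_right_injective (p := i) ?_)
    have h' := Fin.succAbove_succAbove_predAbove (i.succAbove j) (j.predAbove i)
    rwa [h] at h'

/-- The boundary of the boundary of a block carries no flux. -/
theorem sum_flux_faces_eq_zero {m : ℕ} {A : Set (Fin (m + 2) → ℝ)} {φ : (Fin (m + 2) → ℝ) → E}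
    (hA : IsOpen A) (hφ : ContDiffOn ℝ 1 φ A) (ω : DiffForm E m) {B : Box (Fin (m + 2))}
    (hB : Box.Icc B ⊆ A) :
    ∑ i : Fin (m + 2), (-1) ^ (i : ℕ) *
      (flux (pullback (fun s => φ (i.insertNth (B.upper i) s)) ω) (B.face i) -
        flux (pullback (fun s => φ (i.insertNth (B.lower i) s)) ω) (B.face i)) = 0 := by
  -- The integral over a codimension-two face, with the frozen coordinates listed in order of
  -- removal.
  let G : Fin (m + 2) → ℝ → Fin (m + 1) → ℝ → ℝ := fun i a j b =>
    integral ((B.face i).face j) IntegrationParams.Riemann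
      (fun s => pullback φ ω (i.insertNth a (j.insertNth b s : Fin (m + 1) → ℝ))
        fun l => Pi.single (i.succAbove (j.succAbove l)) 1) BoxAdditiveMap.volume
  have hswap : ∀ i a j b, G i a j b = G (i.succAbove j) b (j.predAbove i) a := by
    intro i a j b
    simp only [G]
    rw [face_face_eq_swap]
    congr 1
    ext s
    rw [insertNth_insertNth_eq_swap]
    simp only [Fin.succAbove_succAbove_succAbove_predAbove]
  have hG : ∀ i, ∀ a ∈ Icc (B.lower i) (B.upper i), ∀ j,
      ∀ b ∈ Icc ((B.face i).lower j) ((B.face i).upper j),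
      faceIntegral (pullback (fun s => φ (i.insertNth a s)) ω) j b ((B.face i).face j) =
        G i a j b := by
    intro i a ha j b hb
    refine integral_congr fun s hs => ?_
    exact pullback_comp_insertNth hA hφ ω i a
      (hB (B.mapsTo_insertNth_face_Icc ha ((B.face i).mapsTo_insertNth_face_Icc hb hs))) _
  have hl : ∀ {k : ℕ} (C : Box (Fin k)) (i : Fin k), C.lower i ∈ Icc (C.lower i) (C.upper i) :=
    fun C i => left_mem_Icc.2 (C.lower_le_upper i)
  have hu : ∀ {k : ℕ} (C : Box (Fin k)) (i : Fin k), C.upper i ∈ Icc (C.lower i) (C.upper i) :=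
    fun C i => right_mem_Icc.2 (C.lower_le_upper i)
  -- The four codimension-two faces for a pair of axes are grouped together; the swap only exchanges
  -- the two mixed terms, which carry equal signs.
  have key := sum_neg_one_pow_mul_eq_zero (fun i j =>
    (G i (B.upper i) j (B.upper (i.succAbove j)) - G i (B.upper i) j (B.lower (i.succAbove j))) -
      (G i (B.lower i) j (B.upper (i.succAbove j)) -
        G i (B.lower i) j (B.lower (i.succAbove j)))) (by
    intro i j
    rw [hswap i (B.upper i) j (B.upper _), hswap i (B.upper i) j (B.lower _),
      hswap i (B.lower i) j (B.upper _), hswap i (B.lower i) j (B.lower _),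
      Fin.succAbove_succAbove_predAbove]
    ring)
  rw [← key]
  refine Finset.sum_congr rfl fun i _ => ?_
  rw [flux, flux, ← Finset.sum_sub_distrib, Finset.mul_sum]
  refine Finset.sum_congr rfl fun j _ => ?_
  rw [hG i _ (hu B i) j _ (hu _ j), hG i _ (hu B i) j _ (hl _ j),
    hG i _ (hl B i) j _ (hu _ j), hG i _ (hl B i) j _ (hl _ j), Box.face_upper, Box.face_lower,
    pow_add]
  ring

/-! ### Vanishing flux of `D ω` and conclusion -/

/-- The flux of the pullback of `D ω` vanishes on every block. -/
theorem flux_pullback_D_eq_zero {m : ℕ} {U : Set E} {ω : DiffForm E m}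
    (hω : ContinuousOn ω U) (hder : ∀ x ∈ U, DerivableAt U ω x)
    (hint : ∀ c : SingularBlock U (m + 1), c.IsIntegrable (D U ω))
    {A : Set (Fin (m + 2) → ℝ)} {φ : (Fin (m + 2) → ℝ) → E} (hA : IsOpen A)
    (hφ : ContDiffOn ℝ 1 φ A) (hm : MapsTo φ A U) {B : Box (Fin (m + 2))} (hB : Box.Icc B ⊆ A) :
    flux (pullback φ (D U ω)) B = 0 := by
  have key : ∀ i j, faceIntegral (pullback φ (D U ω)) i (endpoint B i j) (B.face i) =
      flux (pullback (fun s => φ (i.insertNth (endpoint B i j) s)) ω) (B.face i) := by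
    intro i j
    have hmaps := Box.mapsTo_insertNth_face_Icc (I := B) (endpoint_mem B i j)
    have hι := contDiff_insertNth i (endpoint B i j)
    have heq : EqOn
        (fun t => pullback (fun s => φ (i.insertNth (endpoint B i j) s)) (D U ω) t
          fun l => Pi.single l 1)
        (fun t => faceCoeff (pullback φ (D U ω)) i (i.insertNth (endpoint B i j) t))
        (Box.Icc (B.face i)) := fun t ht =>
      pullback_comp_insertNth hA hφ (D U ω) i _ (hB (hmaps ht)) id
    have hI := (integrable_congr (pullbackCoeff_faceBlock hA hφ hm hB i j (D U ω))).1
      (hint (faceBlock hA hφ hm hB i j))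
    -- Stokes on the face, with `φ` restricted to the open slice of `A` by the hyperplane of that
    -- face.
    have hS := integral_pullback_D (φ := fun s => φ (i.insertNth (endpoint B i j) s)) hω hder
      (hA.preimage hι.continuous) (hφ.comp hι.contDiffOn fun _ h => h) (fun _ h => hm h)
      (fun _ h => hB (hmaps h)) ((integrable_congr heq).2 hI)
    rw [← hS, integral_congr heq]
    rfl
  have hu := fun i => key i 1
  have hl := fun i => key i 0
  simp only [endpoint, one_ne_zero, if_true, if_false] at hu hl
  rw [flux]
  simp only [hu, hl]
  exact sum_flux_faces_eq_zero hA hφ ω hB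

theorem hasExtDerivAt_D_zero {m : ℕ} {U : Set E} {ω : DiffForm E m}
    (hω : ContinuousOn ω U) (hder : ∀ x ∈ U, DerivableAt U ω x)
    (hint : ∀ c : SingularBlock U (m + 1), c.IsIntegrable (D U ω)) (x : E) :
    HasExtDerivAt U (D U ω) 0 x := by
  constructor
  · intro A φ p h B hB _
    refine isIntegrable_boundary fun i j => ?_
    exact (integrable_congr (pullbackCoeff_inclusionBlock_face B hB _ i j)).2
      ((integrable_congr (pullbackCoeff_faceBlock h.isOpen h.contDiffOn h.mapsTo hB i j _)).1
        (hint (faceBlock h.isOpen h.contDiffOn h.mapsTo hB i j)))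
  · intro v A φ p h _ ε hε K _
    -- The flux is exactly zero, so any `δ` works and the shape of the block is irrelevant.
    refine ⟨1, one_pos, fun B hB _ _ _ => ?_⟩
    rw [integral_boundary_inclusionBlock,
      flux_pullback_D_eq_zero hω hder hint h.isOpen h.contDiffOn h.mapsTo hB]
    simpa using hε

end FluxForm

end

theorem mainTheorem6 (n m : ℕ) (U : Set (EuclideanSpace ℝ (Fin n))) (hU : IsOpen U)
    (ω : FluxForm.DiffForm (EuclideanSpace ℝ (Fin n)) m) (hcont : ContinuousOn ω U)
    (hder : ∀ x ∈ U, FluxForm.DerivableAt U ω x)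
    (hint : ∀ c : FluxForm.Chain U (m + 1), FluxForm.Chain.IsIntegrable c (FluxForm.D U ω)) :
    (∀ x ∈ U, FluxForm.DerivableAt U (FluxForm.D U ω) x) ∧
      ∀ x ∈ U, FluxForm.D U (FluxForm.D U ω) x = 0 := by
  have hblock : ∀ c : FluxForm.SingularBlock U (m + 1), c.IsIntegrable (FluxForm.D U ω) :=
    fun c => hint (Finsupp.single c 1) c (by simp)
  have h0 := FluxForm.hasExtDerivAt_D_zero hcont hder hblock
  have hd : ∀ x, FluxForm.DerivableAt U (FluxForm.D U ω) x := fun x => ⟨0, h0 x⟩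
  -- `D` is defined by choice, so its value is identified with 0 through uniqueness, which needs `U`
  -- open.
  exact ⟨fun x _ => hd x, fun x hx => (FluxForm.D_spec (hd x)).unique hU hx (h0 x)⟩
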